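/- \textbf{Setting.} A \emph{partition} $\pi$ is a sequence $0=t_0<t_1<\dots$ in $[0,\infty]$ without accumulation points in $[0,\infty)$, possibly taking the value $\infty$ (after which it stays at $\infty$). For a continuous $S\colon[0,\infty)\to\mathbb R$ and $t\ge 0$ put $m(S,\pi[0,t]):=\max_j|S(t_{j+1}\wedge t)-S(t_j\wedge t)|$ and define the discrete local time $$L^\pi_t(u):=\sum_{t_j\in\pi}\mathbf 1_{(\!(S(t_j\wedge t),\,S(t_{j+1}\wedge t)]\!]}(u)\,|S(t_{j+1}\wedge t)-u|,\qquad u\in\mathbb R,$$ where $(\!(a,b]\!]$ denotes $(a,b]$ if $a\le b$ and $(b,a]$ if $a>b$. For $p\ge1$, $g\colon\mathbb R\to\mathbb R$ and $A\subseteq\mathbb R$ let $\|g\|_{p\text{-var},A}:=\sup\big(\sum_{k=1}^n|g(u_k)-g(u_{k-1})|^p\big)^{1/p}$, the supremum being over all $n$ and all $u_0<\dots<u_n$ in $A$; write $\|g\|_{p\text{-var}}$ if $A=\mathbb R$. The function $g$ has locally finite $p$-variation if $\|g\|_{p\text{-var},[a,b]}<\infty$ for all $a<b$. Let $\mathcal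 V^p$ be the space of right-continuous $g\colon\mathbb R\to\mathbb R$ with $\|g\|_{p\text{-var}}<\infty$, with norm $\max\{\|g\|_{p\text{-var}},\|g\|_\infty\}$. For a sequence of partitions $(\pi^n)$, let $\mathcal L_{c,p}(\pi^n)$ be the set of continuous $S\colon[0,\infty)\to\mathbb R$ such that: (i) for every $t\ge0$, $m(S,\pi^n[0,t])\to0$ and $L^{\pi^n}_t$ converges weakly in $L^2(\mathrm du)$; (ii) for every $t\ge0$, $L^{\pi^n}_t$ converges uniformly on $\mathbb R$ to a limit $L_t$, and $(t,u)\mapsto L_t(u)$ is jointly continuous; (iii) $\sup_n\sup_{t\in[0,T]}\|L^{\pi^n}_t\|_{p\text{-var}}<\infty$ for every $T>0$. \textbf{Theorem.} Let $p,q\ge1$ with $\frac1p+\frac1q>1$, let $(\pi^n)$ be a sequence of partitions and let $S\in\mathcal L_{c,p}(\pi^n)$, with continuous local time $L$. (a) Let $f\colon\mathbb R\to\mathbb R$ be absolutely continuous on compact intervals, with a right-continuous Radon--Nikodym derivative $f'$ of locally finite $q$-variation. Then for all $t\in[0,\infty)$ $$f(S(t))=f(S(0))+\int_0^tf'(S(s))\,\mathrm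 dS(s)+\int_{-\infty}^\infty L_t(u)\,\mathrm df'(u),$$ where the limit $$\int_0^tf'(S(s))\,\mathrm dS(s):=\lim_{n\to\infty}\sum_{t_j\in\pi^n}f'(S(t_j))\big(S(t_{j+1}\wedge t)-S(t_j\wedge t)\big)$$ exists, and where $\int_{-\infty}^\infty L_t\,\mathrm df'$ is a Young integral: for all $a\le b$ the Riemann sums $\sum_iL_t(u_i)(f'(u_{i+1})-f'(u_i))$ over partitions of $[a,b]$ converge as the mesh size goes to zero, and their limits converge as $a\to-\infty$, $b\to\infty$. (b) In particular, $\int_0^tg(S(s))\,\mathrm dS(s)$ exists as the limit of the Riemann sums along $(\pi^n)$ for every right-continuous $g$ of locally finite $q$-variation and all $t\ge0$, and for every $T>0$ the map $\mathcal V^q\ni g\mapsto\int_0^\cdot g(S(s))\,\mathrm dS(s)\in C([0,T],\mathbb R)$ is a bounded linear operator. -/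

import Mathlib

open scoped NNReal ENNReal Topology
open Filter MeasureTheory

noncomputable section

/-- A partition `0 = t₀ < t₁ < …` of `[0, ∞)` without accumulation points. The points may take the
value `∞`, and once a point is `∞` all later ones are, which encodes finite partitions. -/
structure TimePartition where
  pt : ℕ → ℝ≥0∞
  pt_zero : pt 0 = 0
  mono : Monotone pt
  lt_succ : ∀ j, pt j ≠ ∞ → pt j < pt (j + 1)
  tendsto_top : Tendsto pt atTop (𝓝 ∞)

/-- The stopped partition point `t_j ∧ t`. -/
def TimePartition.stopped (π : TimePartition) (j : ℕ) (t : ℝ≥0) : ℝ≥0 :=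
  (min (π.pt j) (t : ℝ≥0∞)).toNNReal

/-- The mesh size `m(S, π[0,T])` of `π` along `S`: the largest increment of `S` between consecutive
points of `π` stopped at `T` (only finitely many of them are nonzero). -/
def meshAlong (S : ℝ≥0 → ℝ) (π : TimePartition) (T : ℝ≥0) : ℝ :=
  ⨆ j : ℕ, |S (π.stopped (j + 1) T) - S (π.stopped j T)|

/-- The discrete local time
`L^π_t(S,u) = ∑_j 1_{⦅S(t_j ∧ t), S(t_{j+1} ∧ t)⟧}(u) |S(t_{j+1} ∧ t) - u|`. All but finitely many
summands vanish; `Set.uIoc a b` is `(a,b]` if `a ≤ b` and `(b,a]` otherwise. -/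
def discreteLocalTime (S : ℝ≥0 → ℝ) (π : TimePartition) (t : ℝ≥0) (u : ℝ) : ℝ :=
  ∑' j : ℕ, (Set.uIoc (S (π.stopped j t)) (S (π.stopped (j + 1) t))).indicator
    (fun v => |S (π.stopped (j + 1) t) - v|) u

/-- The Riemann sum `∑_j g(S(t_j)) (S(t_{j+1} ∧ t) - S(t_j ∧ t))` along `π`. All but finitely many
summands vanish, in particular those with `t_j = ∞`. -/
def riemannSum (S : ℝ≥0 → ℝ) (π : TimePartition) (g : ℝ → ℝ) (t : ℝ≥0) : ℝ :=
  ∑' j : ℕ, g (S (π.pt j).toNNReal) * (S (π.stopped (j + 1) t) - S (π.stopped j t))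

/-- `I` is the pathwise integral `∫₀ᵗ g(S(s)) dS(s)` along `(πⁿ)`: the limit of Riemann sums. -/
def HasPathwiseIntegral (S : ℝ≥0 → ℝ) (π : ℕ → TimePartition) (g : ℝ → ℝ) (t : ℝ≥0) (I : ℝ) :
    Prop :=
  Tendsto (fun n => riemannSum S (π n) g t) atTop (𝓝 I)

/-- Weak convergence in `L²(ℝ, du)`. -/
def TendstoWeaklyL2 (φ : ℕ → ℝ → ℝ) (ψ : ℝ → ℝ) : Prop :=
  (∀ n, MemLp (φ n) 2 volume) ∧ MemLp ψ 2 volume ∧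
    ∀ h : ℝ → ℝ, MemLp h 2 volume →
      Tendsto (fun n => ∫ u, φ n u * h u) atTop (𝓝 (∫ u, ψ u * h u))

/-- `L` is an `L²`-local time of `S` along `(πⁿ)`. -/
def IsL2LocalTime (S : ℝ≥0 → ℝ) (π : ℕ → TimePartition) (L : ℝ≥0 → ℝ → ℝ) : Prop :=
  ∀ t : ℝ≥0, Tendsto (fun n => meshAlong S (π n) t) atTop (𝓝 0) ∧
    TendstoWeaklyL2 (fun n => discreteLocalTime S (π n) t) (L t)

/-- The continuous paths having an `L²`-local time along `(πⁿ)`. -/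
def l2LocalTimePaths (π : ℕ → TimePartition) : Set (ℝ≥0 → ℝ) :=
  {S | Continuous S ∧ ∃ L, IsL2LocalTime S π L}

/-- `L` is the continuous local time of `S` along `(πⁿ)`. -/
def IsContinuousLocalTime (S : ℝ≥0 → ℝ) (π : ℕ → TimePartition) (L : ℝ≥0 → ℝ → ℝ) : Prop :=
  S ∈ l2LocalTimePaths π ∧
    (∀ t : ℝ≥0, TendstoUniformly (fun n => discreteLocalTime S (π n) t) (L t) atTop) ∧
    Continuous (fun x : ℝ≥0 × ℝ => L x.1 x.2)

/-- The `p`-variation `sup (∑ |f(u_{k+1}) - f(u_k)|^p)^{1/p}` of `f` on `s`, over finite increasing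
families of points of `s` (repeated points contribute nothing, as `p > 0` in all uses). -/
def pVariationOn (p : ℝ) (f : ℝ → ℝ) (s : Set ℝ) : ℝ≥0∞ :=
  ⨆ x : ℕ × {u : ℕ → ℝ // Monotone u ∧ ∀ i, u i ∈ s},
    (∑ k ∈ Finset.range x.1, edist (f (x.2.1 (k + 1))) (f (x.2.1 k)) ^ p) ^ (1 / p)

/-- The set `𝓛_{c,p}(πⁿ)` of paths with a continuous local time along `(πⁿ)` whose discrete local
times have bounded `p`-variation, uniformly in `n` and in `t ∈ [0,T]`, for every `T`. -/
def localTimePaths (p : ℝ) (π : ℕ → TimePartition) : Set (ℝ≥0 → ℝ) :=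
  {S | (∃ L, IsContinuousLocalTime S π L) ∧
    ∀ T : ℝ≥0, 0 < T →
      (⨆ n : ℕ, ⨆ t ∈ Set.Icc 0 T,
        pVariationOn p (discreteLocalTime S (π n) t) Set.univ) < ∞}

def RightContinuous (g : ℝ → ℝ) : Prop :=
  ∀ x, ContinuousWithinAt g (Set.Ici x) x

def LocallyFinitePVariation (q : ℝ) (g : ℝ → ℝ) : Prop :=
  ∀ a b : ℝ, pVariationOn q g (Set.Icc a b) < ∞

/-- `f` is absolutely continuous (on compact intervals) with Radon-Nikodym derivative `f'`. -/
def IsAbsolutelyContinuousWithDeriv (f f' : ℝ → ℝ) : Prop :=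
  (∀ a b : ℝ, AbsolutelyContinuousOnInterval f a b) ∧ ∀ᵐ x, HasDerivAt f (f' x) x

/-- `I` is the Young integral `∫_a^b φ dg`: the Riemann sums `∑ φ(u_i) (g(u_{i+1}) - g(u_i))` over
partitions of `[a,b]` converge to `I` as the mesh size of the partition goes to zero. -/
def HasYoungIntegralOn (φ g : ℝ → ℝ) (a b : ℝ) (I : ℝ) : Prop :=
  ∀ ε > 0, ∃ δ > 0, ∀ (n : ℕ) (u : ℕ → ℝ), Monotone u → u 0 = a → u n = b →
    (∀ i < n, u (i + 1) - u i < δ) →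
      |∑ i ∈ Finset.range n, φ (u i) * (g (u (i + 1)) - g (u i)) - I| < ε

/-- `I` is the Young integral `∫_{-∞}^∞ φ dg`: the Young integrals over all compact intervals
`[a,b]` exist and converge to `I` as `a → -∞` and `b → ∞`. -/
def HasYoungIntegral (φ g : ℝ → ℝ) (I : ℝ) : Prop :=
  ∃ J : ℝ → ℝ → ℝ, (∀ a b : ℝ, a ≤ b → HasYoungIntegralOn φ g a b (J a b)) ∧
    Tendsto (fun x : ℝ × ℝ => J x.1 x.2) (atBot ×ˢ atTop) (𝓝 I)

theorem pVariationOn_add_le {p : ℝ} (hp : 1 ≤ p) (f g : ℝ → ℝ) (s : Set ℝ) :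
    pVariationOn p (f + g) s ≤ pVariationOn p f s + pVariationOn p g s := by
  refine iSup_le fun x => ?_
  refine le_trans ?_ (add_le_add
    (le_iSup (fun x : ℕ × {u : ℕ → ℝ // Monotone u ∧ ∀ i, u i ∈ s} =>
      (∑ k ∈ Finset.range x.1, edist (f (x.2.1 (k + 1))) (f (x.2.1 k)) ^ p) ^ (1 / p)) x)
    (le_iSup (fun x : ℕ × {u : ℕ → ℝ // Monotone u ∧ ∀ i, u i ∈ s} =>
      (∑ k ∈ Finset.range x.1, edist (g (x.2.1 (k + 1))) (g (x.2.1 k)) ^ p) ^ (1 / p)) x))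
  refine le_trans ?_ (ENNReal.Lp_add_le _ _ _ hp)
  gcongr with k hk
  exact edist_add_add_le _ _ _ _

theorem pVariationOn_smul_le {p : ℝ} (hp : 1 ≤ p) (c : ℝ) (f : ℝ → ℝ) (s : Set ℝ) :
    pVariationOn p (c • f) s ≤ ‖c‖ₑ * pVariationOn p f s := by
  have hp0 : 0 < p := by linarith
  refine iSup_le fun x => ?_
  refine le_trans (le_of_eq ?_) (mul_le_mul_right
    (le_iSup (fun x : ℕ × {u : ℕ → ℝ // Monotone u ∧ ∀ i, u i ∈ s} =>
      (∑ k ∈ Finset.range x.1, edist (f (x.2.1 (k + 1))) (f (x.2.1 k)) ^ p) ^ (1 / p)) x) _)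
  have h : ∀ a b : ℝ, edist (c * a) (c * b) ^ p = ‖c‖ₑ ^ p * edist a b ^ p := fun a b => by
    rw [edist_eq_enorm_sub, edist_eq_enorm_sub, ← mul_sub, enorm_mul,
      ENNReal.mul_rpow_of_nonneg _ _ hp0.le]
  simp only [Pi.smul_apply, smul_eq_mul, h]
  rw [← Finset.mul_sum, ENNReal.mul_rpow_of_nonneg _ _ (by positivity), ← ENNReal.rpow_mul,
    mul_one_div_cancel hp0.ne', ENNReal.rpow_one]

/-- The space `𝒱^q` of right-continuous functions of finite `q`-variation on `ℝ`. -/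
def pVarSpace (q : ℝ) (hq : 1 ≤ q) : Submodule ℝ (ℝ → ℝ) where
  carrier := {g | RightContinuous g ∧ pVariationOn q g Set.univ < ∞}
  zero_mem' := by
    refine ⟨fun x => continuousWithinAt_const, ?_⟩
    have h := pVariationOn_smul_le hq 0 0 Set.univ
    simp only [smul_zero, enorm_zero, zero_mul] at h
    exact h.trans_lt ENNReal.zero_lt_top
  add_mem' := fun {f g} hf hg =>
    ⟨fun x => (hf.1 x).add (hg.1 x),
      (pVariationOn_add_le hq f g _).trans_lt (ENNReal.add_lt_top.2 ⟨hf.2, hg.2⟩)⟩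
  smul_mem' := fun c f hf =>
    ⟨fun x => (hf.1 x).const_smul c,
      (pVariationOn_smul_le hq c f _).trans_lt (ENNReal.mul_lt_top enorm_lt_top hf.2)⟩

/-- The norm of `𝒱^q`: the maximum of the `q`-variation seminorm and the supremum norm. -/
def pVarNorm (q : ℝ) (g : ℝ → ℝ) : ℝ :=
  max (pVariationOn q g Set.univ).toReal (⨆ x : ℝ, |g x|)

end

/-! Removing from a partition the point at which, by Hölder's inequality, the product of the
adjacent increments of `φ` and `g` is smallest, and iterating, bounds the Riemann–Stieltjes sums of
`φ` against `g` by their `p`- and `q`-variations (Love–Young). If `F i → φ` uniformly with bounded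
`p`-variation, then `F i - φ` is small in `r`-variation for every `r > p`, so the Riemann–Stieltjes
sums converge uniformly over all partitions and limit and Young integral may be interchanged.

The discrete local time is a sum, over the steps `c → d` of the path, of the kernels
`∫ x in c..d, (1_{e ≤ x} - 1_{e ≤ c})`, and for right-continuous `g` the Riemann–Stieltjes sums of
`1_{· ≤ x}` against `g` converge to `g x - g a`. Hence its Young integral against `g` is the
difference between `∫ x in S 0..S t, g x` and the Riemann sum of `g ∘ S` along the partition: a
discrete Tanaka–Meyer formula. Interchanging limits along the partitions gives the existence of the
pathwise integral and the change of variable formula; doing so as `s → t` for the local times `L s`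
gives continuity in time. As `L t` vanishes to the left of the range of the path, the Love–Young
bound for its Young integral contains no boundary term, which makes the pathwise integral a bounded
operator. -/

/-- The Riemann–Stieltjes sum `∑_{i<n} φ(u_i) (g(u_{i+1}) - g(u_i))` along the points
`u_0, …, u_n`; the points with index greater than `n` are irrelevant. -/
def stieltjesSum (φ g : ℝ → ℝ) (n : ℕ) (u : ℕ → ℝ) : ℝ :=
  ∑ i ∈ Finset.range n, φ (u i) * (g (u (i + 1)) - g (u i))

section pVariation

variable {p q r : ℝ} {f g : ℝ → ℝ} {s : Set ℝ}

theorem sum_edist_rpow_le_pVariationOn {n : ℕ} {u : ℕ → ℝ} (hu : Monotone u)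
    (hus : ∀ i ≤ n, u i ∈ s) :
    (∑ k ∈ Finset.range n, edist (f (u (k + 1))) (f (u k)) ^ p) ^ (1 / p) ≤
      pVariationOn p f s := by
  refine le_iSup_of_le ⟨n, fun k => u (min k n), fun _ _ h => hu (by omega),
    fun _ => hus _ (min_le_right _ _)⟩ (le_of_eq (congrArg (· ^ (1 / p)) ?_))
  refine Finset.sum_congr rfl fun k hk => ?_
  have hk : k < n := Finset.mem_range.1 hk
  simp only [min_eq_left hk.le, min_eq_left (Nat.succ_le_of_lt hk)]

theorem pVariationOn_mono_set {t : Set ℝ} (h : s ⊆ t) : pVariationOn p f s ≤ pVariationOn p f t :=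
  iSup_le fun x => sum_edist_rpow_le_pVariationOn x.2.2.1 fun i _ => h (x.2.2.2 i)

theorem pVariationOn_sub_le (hp : 1 ≤ p) :
    pVariationOn p (f - g) s ≤ pVariationOn p f s + pVariationOn p g s := by
  have h := pVariationOn_smul_le hp (-1) g s
  rw [neg_one_smul, enorm_neg, enorm_one, one_mul] at h
  rw [sub_eq_add_neg]
  exact (pVariationOn_add_le hp f (-g) s).trans (add_le_add le_rfl h)

theorem edist_le_pVariationOn (hp : 0 < p) {x y : ℝ} (hx : x ∈ s) (hy : y ∈ s) :
    edist (f x) (f y) ≤ pVariationOn p f s := by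
  wlog hxy : y ≤ x generalizing x y
  · exact edist_comm (f x) (f y) ▸ this hy hx (le_of_not_ge hxy)
  have hu : Monotone fun k : ℕ => if k = 0 then y else x :=
    monotone_nat_of_le_succ fun k => by cases k <;> simp [hxy]
  have h := sum_edist_rpow_le_pVariationOn (f := f) (p := p) (n := 1) hu fun i _ => by
    split_ifs <;> assumption
  simpa [← ENNReal.rpow_mul, hp.ne'] using h

theorem pVariationOn_le_of_tendsto {ι : Type*} {l : Filter ι} [l.NeBot]
    {F : ι → ℝ → ℝ} {A : ℝ≥0∞} (hF : ∀ᶠ i in l, pVariationOn p (F i) s ≤ A)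
    (hlim : ∀ x ∈ s, Tendsto (fun i => F i x) l (𝓝 (f x))) : pVariationOn p f s ≤ A := by
  refine iSup_le fun ⟨n, u, hu, hus⟩ => ?_
  have hsum : Tendsto (fun i => (∑ k ∈ Finset.range n,
      edist (F i (u (k + 1))) (F i (u k)) ^ p) ^ (1 / p)) l
      (𝓝 ((∑ k ∈ Finset.range n, edist (f (u (k + 1))) (f (u k)) ^ p) ^ (1 / p))) :=
    (tendsto_finsetSum _ fun k _ =>
      ((hlim _ (hus _)).edist (hlim _ (hus _))).ennrpow_const p).ennrpow_const (1 / p)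
  exact le_of_tendsto hsum
    (hF.mono fun i hi => (sum_edist_rpow_le_pVariationOn hu fun k _ => hus k).trans hi)

theorem pVariationOn_le_mul_of_edist_le (hp : 0 < p) (hpr : p ≤ r) {D : ℝ≥0∞}
    (hD : ∀ x ∈ s, ∀ y ∈ s, edist (f x) (f y) ≤ D) :
    pVariationOn r f s ≤ D ^ (1 - p / r) * pVariationOn p f s ^ (p / r) := by
  have hr : 0 < r := hp.trans_le hpr
  refine iSup_le fun ⟨n, u, hu, hus⟩ => ?_
  have hterm : ∀ k, edist (f (u (k + 1))) (f (u k)) ^ r ≤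
      D ^ (r - p) * edist (f (u (k + 1))) (f (u k)) ^ p := fun k => by
    rw [← sub_add_cancel r p, ENNReal.rpow_add_of_nonneg _ _ (sub_nonneg.2 hpr) hp.le,
      sub_add_cancel]
    gcongr
    exact hD _ (hus _) _ (hus _)
  calc (∑ k ∈ Finset.range n, edist (f (u (k + 1))) (f (u k)) ^ r) ^ (1 / r)
      ≤ (D ^ (r - p) * ∑ k ∈ Finset.range n, edist (f (u (k + 1))) (f (u k)) ^ p) ^ (1 / r) := by
        rw [Finset.mul_sum]
        gcongr with k
        exact hterm k
    _ = D ^ (1 - p / r) *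
          ((∑ k ∈ Finset.range n, edist (f (u (k + 1))) (f (u k)) ^ p) ^ (1 / p)) ^ (p / r) := by
        rw [ENNReal.mul_rpow_of_nonneg _ _ (by positivity), ← ENNReal.rpow_mul, ← ENNReal.rpow_mul]
        congr 2 <;> field_simp
    _ ≤ D ^ (1 - p / r) * pVariationOn p f s ^ (p / r) := by
        gcongr
        exact sum_edist_rpow_le_pVariationOn hu fun k _ => hus k

end pVariation

section LoveYoung

variable {p q r : ℝ} {φ g : ℝ → ℝ} {s : Set ℝ}

/-- By Hölder's inequality the product `f i * g i` is small on average, hence small for some `i`. -/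
theorem exists_mul_le_of_holderTriple {ι : Type*} {s : Finset ι} (hs : s.Nonempty)
    (hpqr : p.HolderTriple q r) (f g : ι → ℝ≥0) :
    ∃ i ∈ s, f i * g i ≤
      (∑ j ∈ s, f j ^ p) ^ (1 / p) * (∑ j ∈ s, g j ^ q) ^ (1 / q) *
        ((s.card : ℝ≥0) ^ (1 / r))⁻¹ := by
  obtain ⟨i, hi, hmin⟩ := s.exists_min_image (fun j => f j * g j) hs
  have hr := hpqr.pos'
  have hcard : (0 : ℝ≥0) < s.card := by exact_mod_cast hs.card_pos
  refine ⟨i, hi, (le_mul_inv_iff₀ (NNReal.rpow_pos hcard)).2 ?_⟩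
  calc f i * g i * (s.card : ℝ≥0) ^ (1 / r)
      = (∑ _j ∈ s, (f i * g i) ^ r) ^ (1 / r) := by
        rw [Finset.sum_const, nsmul_eq_mul, NNReal.mul_rpow, ← NNReal.rpow_mul,
          mul_one_div_cancel hr.ne', NNReal.rpow_one, mul_comm]
    _ ≤ (∑ j ∈ s, (f j * g j) ^ r) ^ (1 / r) := by
        gcongr ?_ ^ (1 / r)
        exact Finset.sum_le_sum fun j hj => NNReal.rpow_le_rpow (hmin j hj) hr.le
    _ ≤ _ := NNReal.Lr_le_Lp_mul_Lq s f g hpqr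

theorem exists_enorm_mul_le_pVariationOn (hp : 0 < p) (hq : 0 < q) {n : ℕ} {u : ℕ → ℝ}
    (hu : Monotone u) (hus : ∀ i ≤ n + 2, u i ∈ s) :
    ∃ k ≤ n, ‖(φ (u (k + 1)) - φ (u k)) * (g (u (k + 2)) - g (u (k + 1)))‖ₑ ≤
      pVariationOn p φ s * pVariationOn q g s * (((n : ℝ≥0∞) + 1) ^ (1 / p + 1 / q))⁻¹ := by
  have hpqr : p.HolderTriple q (1 / p + 1 / q)⁻¹ := ⟨by simp, hp, hq⟩
  obtain ⟨k, hk, hle⟩ := exists_mul_le_of_holderTriple Finset.nonempty_range_add_one hpqr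
    (fun k => nndist (φ (u (k + 1))) (φ (u k))) fun k => nndist (g (u (k + 1 + 1))) (g (u (k + 1)))
  refine ⟨k, Nat.lt_succ_iff.1 (Finset.mem_range.1 hk), ?_⟩
  have hφ := sum_edist_rpow_le_pVariationOn (f := φ) (p := p) (n := n + 1) hu
    fun i hi => hus i (by omega)
  have hg := sum_edist_rpow_le_pVariationOn (f := g) (p := q) (n := n + 1)
    (u := fun k => u (k + 1)) (fun _ _ h => hu (by omega)) fun i hi => hus _ (by omega)
  rw [enorm_mul, ← edist_eq_enorm_sub, ← edist_eq_enorm_sub]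
  refine le_trans ?_ (mul_le_mul_left (mul_le_mul' hφ hg) _)
  have hpos : (0 : ℝ) ≤ 1 / p + 1 / q := by positivity
  have hcast := ENNReal.coe_le_coe.2 hle
  rw [Finset.card_range, one_div (1 / p + 1 / q)⁻¹, inv_inv, ENNReal.coe_mul, ENNReal.coe_mul,
    ENNReal.coe_mul, ENNReal.coe_inv (by positivity), ENNReal.coe_rpow_of_nonneg _ hpos,
    ENNReal.coe_rpow_of_nonneg _ (one_div_nonneg.2 hp.le),
    ENNReal.coe_rpow_of_nonneg _ (one_div_nonneg.2 hq.le), ENNReal.coe_natCast, Nat.cast_succ]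
    at hcast
  simpa only [ENNReal.ofNNReal_finsetSum, ENNReal.coe_rpow_of_nonneg _ hp.le,
    ENNReal.coe_rpow_of_nonneg _ hq.le, edist_nndist] using hcast

theorem stieltjesSum_sub_remove (φ g : ℝ → ℝ) (u : ℕ → ℝ) (j m : ℕ) :
    stieltjesSum φ g (j + m + 2) u -
        stieltjesSum φ g (j + m + 1) (fun k => if k ≤ j then u k else u (k + 1)) =
      (φ (u (j + 1)) - φ (u j)) * (g (u (j + 2)) - g (u (j + 1))) := by
  have hleft : ∀ i ∈ Finset.range j, φ (if i ≤ j then u i else u (i + 1)) *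
      (g (if i + 1 ≤ j then u (i + 1) else u (i + 1 + 1)) - g (if i ≤ j then u i else u (i + 1))) =
      φ (u i) * (g (u (i + 1)) - g (u i)) := fun i hi => by
    have hi := Finset.mem_range.1 hi
    rw [if_pos hi.le, if_pos (Nat.succ_le_of_lt hi)]
  have hright : ∀ i, ¬ j + 1 + i ≤ j := fun i => by omega
  have hsucc : ∀ i, ¬ j + 1 + i + 1 ≤ j := fun i => by omega
  rw [stieltjesSum, stieltjesSum, show j + m + 2 = j + 2 + m by ring,
    show j + m + 1 = j + 1 + m by ring, Finset.sum_range_add _ (j + 2),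
    Finset.sum_range_add _ (j + 1), Finset.sum_range_succ _ (j + 1), Finset.sum_range_succ _ j,
    Finset.sum_range_succ _ j, Finset.sum_congr rfl hleft]
  simp only [hright, hsucc, if_false, le_refl, if_true, Nat.not_succ_le_self,
    show ∀ i, j + 2 + i = j + 1 + i + 1 from fun i => by ring]
  ring

theorem enorm_stieltjesSum_sub_le_sum (hp : 0 < p) (hq : 0 < q) {n : ℕ} {u : ℕ → ℝ}
    (hu : Monotone u) (hus : ∀ i ≤ n + 1, u i ∈ s) :
    ‖stieltjesSum φ g (n + 1) u - φ (u 0) * (g (u (n + 1)) - g (u 0))‖ₑ ≤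
      pVariationOn p φ s * pVariationOn q g s *
        ∑ k ∈ Finset.range n, (((k : ℝ≥0∞) + 1) ^ (1 / p + 1 / q))⁻¹ := by
  induction n generalizing u with
  | zero => simp [stieltjesSum]
  | succ n ih =>
    obtain ⟨j, hj, hle⟩ := exists_enorm_mul_le_pVariationOn (φ := φ) (g := g) hp hq hu hus
    obtain ⟨m, rfl⟩ := Nat.exists_eq_add_of_le hj
    have hremove := stieltjesSum_sub_remove φ g u j m
    set v : ℕ → ℝ := fun k => if k ≤ j then u k else u (k + 1) with hv
    have hv_mono : Monotone v := fun a b hab => by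
      simp only [hv]
      split_ifs <;> exact hu (by omega)
    have hv_mem : ∀ i ≤ j + m + 1, v i ∈ s := fun i hi => by
      simp only [hv]
      split_ifs <;> exact hus _ (by omega)
    have hv_first : v 0 = u 0 := if_pos (Nat.zero_le j)
    have hv_last : v (j + m + 1) = u (j + m + 2) := if_neg (by omega)
    have hv_le := ih hv_mono hv_mem
    rw [hv_first, hv_last] at hv_le
    rw [Finset.sum_range_succ, mul_add]
    calc _ = ‖(stieltjesSum φ g (j + m + 1) v - φ (u 0) * (g (u (j + m + 2)) - g (u 0))) +
            (φ (u (j + 1)) - φ (u j)) * (g (u (j + 2)) - g (u (j + 1)))‖ₑ := by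
          rw [← hremove]
          congr 1
          ring
      _ ≤ _ := (enorm_add_le _ _).trans (add_le_add hv_le hle)

/-- The constant `∑_{k ≥ 1} k^{-(1/p+1/q)}` of the Love–Young estimate. -/
noncomputable def youngConst (p q : ℝ) : ℝ≥0∞ :=
  ∑' k : ℕ, (((k : ℝ≥0∞) + 1) ^ (1 / p + 1 / q))⁻¹

theorem youngConst_ne_top (hpq : 1 < 1 / p + 1 / q) : youngConst p q ≠ ∞ := by
  have hsum : Summable fun k : ℕ => (((k + 1 : ℕ) : ℝ≥0) ^ (1 / p + 1 / q))⁻¹ :=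
    (NNReal.summable_nat_add_iff 1).2 (NNReal.summable_rpow_inv.2 hpq)
  refine ne_of_eq_of_ne (tsum_congr fun k => ?_) (ENNReal.tsum_coe_ne_top_iff_summable.2 hsum)
  rw [ENNReal.coe_inv (by positivity), ENNReal.coe_rpow_of_nonneg _ (by linarith),
    ENNReal.coe_natCast, Nat.cast_succ]

/-- The **Love–Young estimate**. -/
theorem enorm_stieltjesSum_sub_le (hp : 0 < p) (hq : 0 < q) {n : ℕ} {u : ℕ → ℝ}
    (hu : Monotone u) (hus : ∀ i ≤ n, u i ∈ s) :
    ‖stieltjesSum φ g n u - φ (u 0) * (g (u n) - g (u 0))‖ₑ ≤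
      youngConst p q * pVariationOn p φ s * pVariationOn q g s := by
  rcases n with _ | n
  · simp [stieltjesSum]
  refine (enorm_stieltjesSum_sub_le_sum hp hq hu hus).trans ?_
  rw [mul_comm, mul_assoc (youngConst p q)]
  exact mul_le_mul_left (ENNReal.sum_le_tsum _) _

end LoveYoung

section UniformConvergence

variable {ι : Type*} {l : Filter ι} {p q : ℝ} {F : ι → ℝ → ℝ} {φ ψ g : ℝ → ℝ} {s : Set ℝ}

theorem stieltjesSum_sub (φ ψ g : ℝ → ℝ) (n : ℕ) (u : ℕ → ℝ) :
    stieltjesSum (φ - ψ) g n u = stieltjesSum φ g n u - stieltjesSum ψ g n u := by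
  simp only [stieltjesSum, Pi.sub_apply, sub_mul, Finset.sum_sub_distrib]

theorem exists_gt_one_lt_one_div_add_one_div (hp : 0 < p) (hpq : 1 < 1 / p + 1 / q) :
    ∃ r > p, 1 < 1 / r + 1 / q := by
  have hcont : ContinuousAt (fun r : ℝ => 1 / r + 1 / q) p :=
    (continuousAt_const.div continuousAt_id hp.ne').add continuousAt_const
  have hev : ∀ᶠ r in 𝓝[>] p, 1 < 1 / r + 1 / q :=
    nhdsWithin_le_nhds (hcont.eventually_const_lt hpq)
  exact (hev.and self_mem_nhdsWithin).exists.imp fun r hr => ⟨hr.2, hr.1⟩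

theorem enorm_stieltjesSum_le {r : ℝ} (hp : 0 < p) (hpr : p ≤ r) (hq : 0 < q) {D : ℝ≥0∞}
    (hφ : ∀ x ∈ s, ‖φ x‖ₑ ≤ D) {n : ℕ} {u : ℕ → ℝ} (hu : Monotone u) (hus : ∀ i ≤ n, u i ∈ s) :
    ‖stieltjesSum φ g n u‖ₑ ≤
      (D + youngConst r q * ((2 * D) ^ (1 - p / r) * pVariationOn p φ s ^ (p / r))) *
        pVariationOn q g s := by
  have hosc : ∀ x ∈ s, ∀ y ∈ s, edist (φ x) (φ y) ≤ 2 * D := fun x hx y hy => by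
    rw [edist_eq_enorm_sub, two_mul]
    exact enorm_sub_le.trans (add_le_add (hφ x hx) (hφ y hy))
  have hends : ‖φ (u 0) * (g (u n) - g (u 0))‖ₑ ≤ D * pVariationOn q g s := by
    rw [enorm_mul, ← edist_eq_enorm_sub]
    exact mul_le_mul' (hφ _ (hus 0 n.zero_le))
      (edist_le_pVariationOn hq (hus n le_rfl) (hus 0 n.zero_le))
  calc ‖stieltjesSum φ g n u‖ₑ
      ≤ ‖φ (u 0) * (g (u n) - g (u 0))‖ₑ +
          ‖stieltjesSum φ g n u - φ (u 0) * (g (u n) - g (u 0))‖ₑ := by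
        simpa only [add_sub_cancel] using enorm_add_le (φ (u 0) * (g (u n) - g (u 0)))
          (stieltjesSum φ g n u - φ (u 0) * (g (u n) - g (u 0)))
    _ ≤ D * pVariationOn q g s +
          youngConst r q * pVariationOn r φ s * pVariationOn q g s :=
        add_le_add hends (enorm_stieltjesSum_sub_le (hp.trans_le hpr) hq hu hus)
    _ ≤ _ := by
        rw [← add_mul]
        gcongr
        exact pVariationOn_le_mul_of_edist_le hp hpr hosc

/-- Given a uniform bound on the `p`-variations, interpolation makes the `r`-variation of `F i - φ`
small for every `r > p`, so that the Love–Young estimate applies to `F i - φ` and `g`. -/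
theorem tendstoUniformlyOn_stieltjesSum (hp : 1 ≤ p) (hq : 0 < q) (hpq : 1 < 1 / p + 1 / q)
    {A : ℝ≥0∞} (hA : A ≠ ∞) (hF : TendstoUniformlyOn F φ l s)
    (hvar : ∀ᶠ i in l, pVariationOn p (F i) s ≤ A) (hg : pVariationOn q g s ≠ ∞) :
    TendstoUniformlyOn (fun i (x : ℕ × (ℕ → ℝ)) => stieltjesSum (F i) g x.1 x.2)
      (fun x => stieltjesSum φ g x.1 x.2) l {x | Monotone x.2 ∧ ∀ k ≤ x.1, x.2 k ∈ s} := by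
  rcases l.eq_or_neBot with rfl | _
  · exact fun _ _ => eventually_bot
  have hp0 : 0 < p := one_pos.trans_le hp
  have hφ : pVariationOn p φ s ≤ A := pVariationOn_le_of_tendsto hvar fun x hx => hF.tendsto_at hx
  obtain ⟨r, hpr, hrq⟩ := exists_gt_one_lt_one_div_add_one_div hp0 hpq
  have hr0 : 0 < r := hp0.trans hpr
  set err : ℝ≥0∞ → ℝ≥0∞ := fun D =>
    (D + youngConst r q * ((2 * D) ^ (1 - p / r) * (A + A) ^ (p / r))) * pVariationOn q g s
    with herr
  have herr_tendsto : Tendsto err (𝓝 0) (𝓝 0) := by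
    have hpow : Tendsto (fun D : ℝ≥0∞ => (2 * D) ^ (1 - p / r)) (𝓝 0) (𝓝 0) := by
      have h := (ENNReal.Tendsto.const_mul (a := 2) (tendsto_id (x := 𝓝 (0 : ℝ≥0∞)))
        (Or.inr ENNReal.ofNat_ne_top)).ennrpow_const (1 - p / r)
      rwa [mul_zero, ENNReal.zero_rpow_of_pos (sub_pos.2 ((div_lt_one hr0).2 hpr))] at h
    have hAtop : (A + A) ^ (p / r) ≠ ∞ :=
      ENNReal.rpow_ne_top_of_nonneg (by positivity) (ENNReal.add_ne_top.2 ⟨hA, hA⟩)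
    simpa using ENNReal.Tendsto.mul_const (tendsto_id.add (ENNReal.Tendsto.const_mul
      (ENNReal.Tendsto.mul_const hpow (Or.inr hAtop)) (Or.inr (youngConst_ne_top hrq))))
      (Or.inr hg)
  rw [EMetric.tendstoUniformlyOn_iff] at hF ⊢
  intro ε hε
  have hsmall : ∀ᶠ D in 𝓝[>] 0, err D < ε :=
    nhdsWithin_le_nhds (herr_tendsto.eventually_lt_const hε)
  obtain ⟨D, hDε, hD⟩ := (hsmall.and self_mem_nhdsWithin).exists
  filter_upwards [hF D hD, hvar] with i hi hvi x hx
  rw [edist_eq_enorm_sub, ← stieltjesSum_sub]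
  refine (enorm_stieltjesSum_le hp0 hpr.le hq
    (fun y hy => edist_eq_enorm_sub (φ y) _ ▸ (hi y hy).le) hx.1 hx.2).trans_lt (hDε.trans_le' ?_)
  simp only [herr]
  gcongr
  exact (pVariationOn_sub_le hp).trans (add_le_add hφ hvi)

end UniformConvergence

section VanishingMesh

variable {φ g : ℝ → ℝ} {a b : ℝ}

/-- The mesh size of the family of points `u 0 ≤ … ≤ u n`, where `x = (n, u)`. -/
def partitionMesh (x : ℕ × (ℕ → ℝ)) : ℝ≥0 :=
  (Finset.range x.1).sup fun i => (x.2 (i + 1) - x.2 i).toNNReal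

/-- The filter of partitions `a = u 0 ≤ … ≤ u n = b` with mesh size tending to zero. Young integrals
are limits along it. -/
def vanishingMesh (a b : ℝ) : Filter (ℕ × (ℕ → ℝ)) :=
  comap partitionMesh (𝓝 0) ⊓ 𝓟 {x | Monotone x.2 ∧ x.2 0 = a ∧ x.2 x.1 = b}

instance : (vanishingMesh a b).IsCountablyGenerated := by
  rw [vanishingMesh]; infer_instance

theorem partitionMesh_lt_iff {x : ℕ × (ℕ → ℝ)} (hx : Monotone x.2) {δ : ℝ≥0} (hδ : 0 < δ) :
    partitionMesh x < δ ↔ ∀ i < x.1, x.2 (i + 1) - x.2 i < δ := by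
  simp only [partitionMesh, Finset.sup_lt_iff (bot_lt_iff_ne_bot.2 hδ.ne'), Finset.mem_range,
    Real.toNNReal_lt_iff_lt_coe (sub_nonneg.2 (hx (Nat.le_succ _)))]

theorem le_partitionMesh {x : ℕ × (ℕ → ℝ)} {i : ℕ} (hi : i < x.1) :
    x.2 (i + 1) - x.2 i ≤ partitionMesh x :=
  (Real.le_coe_toNNReal _).trans (NNReal.coe_le_coe.2
    (Finset.le_sup (f := fun i => (x.2 (i + 1) - x.2 i).toNNReal) (Finset.mem_range.2 hi)))

theorem tendsto_partitionMesh : Tendsto partitionMesh (vanishingMesh a b) (𝓝 0) :=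
  tendsto_comap.mono_left inf_le_left

theorem eventually_isPartition :
    ∀ᶠ x in vanishingMesh a b, Monotone x.2 ∧ x.2 0 = a ∧ x.2 x.1 = b :=
  mem_inf_of_right (mem_principal_self _)

theorem vanishingMesh_hasBasis : (vanishingMesh a b).HasBasis (fun δ : ℝ≥0 => 0 < δ) fun δ =>
    {x | partitionMesh x < δ ∧ Monotone x.2 ∧ x.2 0 = a ∧ x.2 x.1 = b} :=
  (NNReal.nhds_zero_basis.comap _).inf_principal _

theorem vanishingMesh_neBot (hab : a ≤ b) : (vanishingMesh a b).NeBot := by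
  refine vanishingMesh_hasBasis.neBot_iff.2 fun {δ} hδ => ?_
  have hδ' : (0 : ℝ) < (δ / 2 : ℝ≥0) := by positivity
  obtain ⟨n, hn⟩ := Set.Icc.addNSMul_eq_right hab hδ'
  have hmono : Monotone fun k => (Set.Icc.addNSMul hab (δ / 2 : ℝ≥0) k : ℝ) :=
    Set.Icc.monotone_addNSMul hab hδ'.le
  refine ⟨(n, fun k => Set.Icc.addNSMul hab (δ / 2 : ℝ≥0) k), ?_, hmono,
    Set.Icc.addNSMul_zero hab, hn n le_rfl⟩
  refine (partitionMesh_lt_iff hmono hδ).2 fun i _ => ?_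
  exact ((le_abs_self _).trans (Set.Icc.abs_sub_addNSMul_le hab hδ'.le i
    ⟨hmono i.le_succ, le_rfl⟩)).trans_lt (NNReal.coe_lt_coe.2 (half_lt_self hδ))

theorem hasYoungIntegralOn_iff_tendsto {I : ℝ} : HasYoungIntegralOn φ g a b I ↔
    Tendsto (fun x => stieltjesSum φ g x.1 x.2) (vanishingMesh a b) (𝓝 I) := by
  rw [vanishingMesh_hasBasis.tendsto_iff Metric.nhds_basis_ball]
  refine forall₂_congr fun ε _ => ⟨fun ⟨δ, hδ, h⟩ => ?_, fun ⟨δ, hδ, h⟩ => ?_⟩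
  · lift δ to ℝ≥0 using hδ.le
    exact ⟨δ, hδ, fun x ⟨hmesh, hx, ha, hb⟩ =>
      h x.1 x.2 hx ha hb ((partitionMesh_lt_iff hx hδ).1 hmesh)⟩
  · exact ⟨δ, hδ, fun n u hu ha hb hmesh =>
      h (n, u) ⟨(partitionMesh_lt_iff hu hδ).2 hmesh, hu, ha, hb⟩⟩

theorem HasYoungIntegralOn.unique {I J : ℝ} (hab : a ≤ b) (hI : HasYoungIntegralOn φ g a b I)
    (hJ : HasYoungIntegralOn φ g a b J) : I = J :=
  have := vanishingMesh_neBot hab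
  tendsto_nhds_unique (hasYoungIntegralOn_iff_tendsto.1 hI) (hasYoungIntegralOn_iff_tendsto.1 hJ)

theorem HasYoungIntegralOn.enorm_sub_le {p q J : ℝ} (hp : 0 < p) (hq : 0 < q) (hab : a ≤ b)
    (hJ : HasYoungIntegralOn φ g a b J) :
    ‖J - φ a * (g b - g a)‖ₑ ≤
      youngConst p q * pVariationOn p φ (Set.Icc a b) * pVariationOn q g (Set.Icc a b) := by
  have := vanishingMesh_neBot hab
  refine le_of_tendsto ((hasYoungIntegralOn_iff_tendsto.1 hJ).sub_const _).enorm
    (eventually_isPartition.mono ?_)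
  rintro ⟨n, u⟩ ⟨hu, rfl, rfl⟩
  exact enorm_stieltjesSum_sub_le hp hq hu fun i hi => ⟨hu i.zero_le, hu hi⟩

end VanishingMesh

section Closure

theorem exists_tendsto_of_tendstoUniformlyOnFilter {ι α E : Type*} [PseudoMetricSpace E]
    [CompleteSpace E] {l : Filter ι} {l' : Filter α} [l.NeBot] [l'.NeBot] {F : ι → α → E}
    {f : α → E} {J : ι → E} (hF : TendstoUniformlyOnFilter F f l l')
    (hJ : ∀ᶠ i in l, Tendsto (F i) l' (𝓝 (J i))) :
    ∃ I, Tendsto J l (𝓝 I) ∧ Tendsto f l' (𝓝 I) := by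
  have hcauchy : Cauchy (l.map J) := by
    refine Metric.cauchy_iff.2 ⟨inferInstance, fun ε hε => ?_⟩
    obtain ⟨P, hP, Q, hQ, hPQ⟩ := eventually_prod_iff.1
      (Metric.tendstoUniformlyOnFilter_iff.1 hF (ε / 3) (by positivity))
    refine ⟨J '' {i | P i ∧ Tendsto (F i) l' (𝓝 (J i))}, image_mem_map (hP.and hJ), ?_⟩
    rintro _ ⟨i, ⟨hPi, hi⟩, rfl⟩ _ ⟨j, ⟨hPj, hj⟩, rfl⟩
    refine (le_of_tendsto (hi.dist hj) (hQ.mono fun x hx => ?_)).trans_lt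
      (by linarith : 2 * (ε / 3) < ε)
    linarith [dist_triangle_left (F i x) (F j x) (f x), hPQ hPi hx, hPQ hPj hx]
  obtain ⟨I, hI⟩ := CompleteSpace.complete hcauchy
  exact ⟨I, hI, hF.tendsto_of_eventually_tendsto hJ hI⟩

variable {ι : Type*} {l : Filter ι} {p q a b : ℝ} {F : ι → ℝ → ℝ} {φ g : ℝ → ℝ} {J : ι → ℝ}

theorem HasYoungIntegralOn.exists_of_tendstoUniformlyOn [l.NeBot] (hp : 1 ≤ p) (hq : 0 < q)
    (hpq : 1 < 1 / p + 1 / q) (hab : a ≤ b) {A : ℝ≥0∞} (hA : A ≠ ∞)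
    (hF : TendstoUniformlyOn F φ l (Set.Icc a b))
    (hvar : ∀ᶠ i in l, pVariationOn p (F i) (Set.Icc a b) ≤ A)
    (hg : pVariationOn q g (Set.Icc a b) ≠ ∞)
    (hJ : ∀ i, HasYoungIntegralOn (F i) g a b (J i)) :
    ∃ I, Tendsto J l (𝓝 I) ∧ HasYoungIntegralOn φ g a b I := by
  have := vanishingMesh_neBot hab
  simp only [hasYoungIntegralOn_iff_tendsto] at hJ ⊢
  have hpartition : {x : ℕ × (ℕ → ℝ) | Monotone x.2 ∧ ∀ k ≤ x.1, x.2 k ∈ Set.Icc a b} ∈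
      vanishingMesh a b :=
    eventually_isPartition.mono fun x ⟨hx, ha, hb⟩ =>
      ⟨hx, fun k hk => ⟨ha ▸ hx k.zero_le, hb ▸ hx hk⟩⟩
  exact exists_tendsto_of_tendstoUniformlyOnFilter
    ((tendstoUniformlyOn_stieltjesSum hp hq hpq hA hF hvar hg).tendstoUniformlyOnFilter.mono_right
      (le_principal_iff.2 hpartition)) (Eventually.of_forall hJ)

end Closure

section StepFunctions

variable {q a b : ℝ} {g : ℝ → ℝ}

/-- The function which agrees with `g` on `[a, b]` and is constant to the left and to the right of
this interval. It is what integration against `dg` over `[a, b]` sees of `g`. -/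
def constExtend (g : ℝ → ℝ) (a b : ℝ) (y : ℝ) : ℝ := g (max a (min b y))

theorem constExtend_of_mem {y : ℝ} (hy : y ∈ Set.Icc a b) : constExtend g a b y = g y := by
  rw [constExtend, min_eq_right hy.2, max_eq_right hy.1]

theorem exists_stieltjesSum_indicator_eq (g : ℝ → ℝ) {x : ℕ × (ℕ → ℝ)}
    (hx : Monotone x.2 ∧ x.2 0 = a ∧ x.2 x.1 = b) (y : ℝ) :
    ∃ z ∈ Set.Icc (max a (min b y)) b, z ≤ max a (min b y) + partitionMesh x ∧
      stieltjesSum ((Set.Iic y).indicator 1) g x.1 x.2 = g z - g a := by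
  obtain ⟨n, u⟩ := x
  obtain ⟨hu, rfl, rfl⟩ := hx
  dsimp only at hu ⊢
  obtain ⟨m, hmn, hbefore, hafter⟩ : ∃ m ≤ n, (∀ k < m, u k ≤ y) ∧ (m = n ∨ y < u m) := by
    have hex : ∃ m, m = n ∨ y < u m := ⟨n, Or.inl rfl⟩
    exact ⟨Nat.find hex, Nat.find_min' hex (Or.inl rfl),
      fun k hk => not_lt.1 fun h => Nat.find_min hex hk (Or.inr h), Nat.find_spec hex⟩
  refine ⟨u m, ⟨max_le (hu m.zero_le) ?_, hu hmn⟩, ?_, ?_⟩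
  · rcases hafter with rfl | h
    · exact min_le_left _ _
    · exact (min_le_right _ _).trans h.le
  · rcases m with _ | k
    · exact (le_max_left _ _).trans (le_add_of_nonneg_right NNReal.zero_le_coe)
    · have hmesh : u (k + 1) - u k ≤ partitionMesh (n, u) := le_partitionMesh (x := (n, u)) hmn
      have hle : u k ≤ max (u 0) (min (u n) y) :=
        (le_min (hu (by omega)) (hbefore k k.lt_succ_self)).trans (le_max_right _ _)
      linarith
  · obtain ⟨d, rfl⟩ := Nat.exists_eq_add_of_le hmn
    rw [stieltjesSum, Finset.sum_range_add, ← Finset.sum_range_sub (fun i => g (u i)),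
      add_eq_left.2]
    · refine Finset.sum_congr rfl fun i hi => ?_
      have hy : u i ∈ Set.Iic y := hbefore i (Finset.mem_range.1 hi)
      rw [Set.indicator_of_mem hy, Pi.one_apply, one_mul]
    · refine Finset.sum_eq_zero fun i hi => ?_
      have hi := Finset.mem_range.1 hi
      have hy : y < u (m + i) := (hafter.resolve_left (by omega)).trans_le (hu (by omega))
      rw [Set.indicator_of_notMem (Set.notMem_Iic.2 hy), zero_mul]

theorem tendsto_stieltjesSum_indicator (hgc : RightContinuous g) (y : ℝ) :
    Tendsto (fun x => stieltjesSum ((Set.Iic y).indicator 1) g x.1 x.2) (vanishingMesh a b)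
      (𝓝 (constExtend g a b y - g a)) := by
  refine Metric.tendsto_nhds.2 fun ε hε => ?_
  obtain ⟨δ, hδ, hclose⟩ := Metric.continuousWithinAt_iff.1 (hgc (max a (min b y))) ε hε
  lift δ to ℝ≥0 using hδ.le
  have hmesh : ∀ᶠ x in vanishingMesh a b, partitionMesh x < δ :=
    tendsto_partitionMesh.eventually_lt_const hδ
  filter_upwards [hmesh, eventually_isPartition] with x hxδ hx
  obtain ⟨z, hz, hzmesh, hsum⟩ := exists_stieltjesSum_indicator_eq g hx y
  rw [hsum, dist_sub_right]
  refine hclose hz.1 ?_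
  rw [Real.dist_eq, abs_of_nonneg (sub_nonneg.2 hz.1)]
  exact (sub_le_iff_le_add'.2 hzmesh).trans_lt (NNReal.coe_lt_coe.2 hxδ)

theorem intervalIntegrable_indicator_Iic (c d e : ℝ) :
    IntervalIntegrable (fun x => (Set.Iic x).indicator (1 : ℝ → ℝ) e) volume c d :=
  Monotone.intervalIntegrable fun _ _ h =>
    Set.indicator_le_indicator_of_subset (Set.Iic_subset_Iic.2 h) (fun _ => zero_le_one) e

theorem integral_indicator_Iic (c d e : ℝ) :
    ∫ x in c..d, (Set.Iic x).indicator (1 : ℝ → ℝ) e = max (d - e) 0 - max (c - e) 0 := by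
  refine intervalIntegral.integral_eq_sub_of_hasDeriv_right (f := fun x => max (x - e) 0)
    (by fun_prop) (fun x _ => ?_) (intervalIntegrable_indicator_Iic c d e)
  rcases le_or_gt e x with h | h
  · rw [Set.indicator_of_mem (Set.mem_Iic.2 h), Pi.one_apply]
    refine ((hasDerivAt_id x).sub_const e).hasDerivWithinAt.congr (fun y hy => ?_) ?_
    · exact max_eq_left (sub_nonneg.2 (h.trans (le_of_lt hy)))
    · exact max_eq_left (sub_nonneg.2 h)
  · rw [Set.indicator_of_notMem (Set.notMem_Iic.2 h)]
    refine HasDerivAt.hasDerivWithinAt ((hasDerivAt_const x (0 : ℝ)).congr_of_eventuallyEq ?_)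
    filter_upwards [Iio_mem_nhds h] with y hy
    exact max_eq_right (sub_nonpos.2 (le_of_lt hy))

/-- The contribution `1_{⦅c,d⟧}(e) |d - e|` of a single step of the path from `c` to `d` to the
discrete local time at `e`. -/
noncomputable def stepKernel (c d e : ℝ) : ℝ := (Set.uIoc c d).indicator (fun v => |d - v|) e

theorem stepKernel_eq_integral (c d e : ℝ) : stepKernel c d e =
    ∫ x in c..d, ((Set.Iic x).indicator 1 e - (Set.Iic c).indicator 1 e) := by
  rw [intervalIntegral.integral_sub (intervalIntegrable_indicator_Iic c d e)
    intervalIntegrable_const, integral_indicator_Iic, intervalIntegral.integral_const, stepKernel,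
    smul_eq_mul]
  classical
  simp only [Set.indicator_apply, Set.mem_uIoc, Set.mem_Iic, Pi.one_apply]
  grind

theorem stieltjesSum_stepKernel (g : ℝ → ℝ) (c d : ℝ) (n : ℕ) (u : ℕ → ℝ) :
    stieltjesSum (stepKernel c d) g n u =
      ∫ x in c..d, (stieltjesSum ((Set.Iic x).indicator 1) g n u -
        stieltjesSum ((Set.Iic c).indicator 1) g n u) := by
  simp only [stieltjesSum, ← Finset.sum_sub_distrib, ← sub_mul]
  rw [intervalIntegral.integral_finsetSum fun i _ =>
    ((intervalIntegrable_indicator_Iic c d _).sub intervalIntegrable_const).mul_const _]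
  simp only [stepKernel_eq_integral, intervalIntegral.integral_mul_const]

theorem intervalIntegrable_stieltjesSum_indicator (g : ℝ → ℝ) (n : ℕ) (u : ℕ → ℝ) (c d : ℝ) :
    IntervalIntegrable (fun x => stieltjesSum ((Set.Iic x).indicator 1) g n u) volume c d := by
  have h := IntervalIntegrable.sum (μ := volume) (a := c) (b := d) (Finset.range n)
    fun i _ => (intervalIntegrable_indicator_Iic c d (u i)).mul_const (g (u (i + 1)) - g (u i))
  rwa [Finset.sum_fn] at h

theorem abs_sub_le_pVariationOn {s : Set ℝ} (hq : 0 < q) (hg : pVariationOn q g s ≠ ∞) {x y : ℝ}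
    (hx : x ∈ s) (hy : y ∈ s) : |g x - g y| ≤ (pVariationOn q g s).toReal := by
  rw [← Real.dist_eq, ← ENNReal.toReal_ofReal dist_nonneg, ← edist_dist]
  exact ENNReal.toReal_mono hg (edist_le_pVariationOn hq hx hy)

theorem intervalIntegrable_constExtend (hq : 0 < q) (hab : a ≤ b) (hgc : RightContinuous g)
    (hg : pVariationOn q g (Set.Icc a b) ≠ ∞) (c d : ℝ) :
    IntervalIntegrable (constExtend g a b) volume c d := by
  have := vanishingMesh_neBot hab
  have hmeas : AEStronglyMeasurable (constExtend g a b) (volume.restrict (Set.uIoc c d)) :=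
    aestronglyMeasurable_of_tendsto_ae (vanishingMesh a b)
      (fun x => ((intervalIntegrable_stieltjesSum_indicator g x.1 x.2 c d).add
        (intervalIntegrable_const (c := g a))).aestronglyMeasurable_restrict_uIoc)
      (Eventually.of_forall fun y => by
        simpa using (tendsto_stieltjesSum_indicator (a := a) (b := b) hgc y).add_const (g a))
  refine (intervalIntegrable_const (c := |g a| + (pVariationOn q g (Set.Icc a b)).toReal)).mono_fun
    hmeas (Eventually.of_forall fun y => ?_)
  have hclamp : max a (min b y) ∈ Set.Icc a b := ⟨le_max_left _ _, max_le hab (min_le_left _ _)⟩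
  have hle := abs_sub_le_pVariationOn hq hg hclamp (Set.left_mem_Icc.2 hab)
  refine le_trans (b := |g a| + _) ?_ (le_abs_self _)
  change |g (max a (min b y))| ≤ _
  linarith [abs_sub_abs_le_abs_sub (g (max a (min b y))) (g a)]

theorem hasYoungIntegralOn_stepKernel (hq : 0 < q) (hgc : RightContinuous g)
    (hg : pVariationOn q g (Set.Icc a b) ≠ ∞) (c d : ℝ) :
    HasYoungIntegralOn (stepKernel c d) g a b
      (∫ x in c..d, (constExtend g a b x - constExtend g a b c)) := by
  simp only [hasYoungIntegralOn_iff_tendsto, stieltjesSum_stepKernel]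
  refine intervalIntegral.tendsto_integral_filter_of_dominated_convergence
    (fun _ => (pVariationOn q g (Set.Icc a b)).toReal) (Eventually.of_forall fun x => ?_) ?_
    intervalIntegrable_const (Eventually.of_forall fun y _ => ?_)
  · exact ((intervalIntegrable_stieltjesSum_indicator g x.1 x.2 c d).sub
      intervalIntegrable_const).aestronglyMeasurable_restrict_uIoc
  · filter_upwards [eventually_isPartition] with x hx
    refine Eventually.of_forall fun y _ => ?_
    obtain ⟨z, hz, -, hsum⟩ := exists_stieltjesSum_indicator_eq g hx y
    obtain ⟨w, hw, -, hsum'⟩ := exists_stieltjesSum_indicator_eq g hx c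
    rw [hsum, hsum', sub_sub_sub_cancel_right, Real.norm_eq_abs]
    exact abs_sub_le_pVariationOn hq hg ⟨(le_max_left _ _).trans hz.1, hz.2⟩
      ⟨(le_max_left _ _).trans hw.1, hw.2⟩
  · simpa using (tendsto_stieltjesSum_indicator (a := a) (b := b) hgc y).sub
      (tendsto_stieltjesSum_indicator hgc c)

end StepFunctions

theorem LocallyFinitePVariation.intervalIntegrable {q : ℝ} {g : ℝ → ℝ} (hq : 0 < q)
    (hgc : RightContinuous g) (hg : LocallyFinitePVariation q g) (c d : ℝ) :
    IntervalIntegrable g volume c d :=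
  (intervalIntegrable_constExtend hq min_le_max hgc (hg _ _).ne c d).congr fun _ hx =>
    constExtend_of_mem (Set.uIoc_subset_uIcc hx)

namespace TimePartition

variable (π : TimePartition)

theorem stopped_zero (t : ℝ≥0) : π.stopped 0 t = 0 := by simp [stopped, π.pt_zero]

theorem stopped_le (j : ℕ) (t : ℝ≥0) : π.stopped j t ≤ t :=
  ENNReal.toNNReal_mono ENNReal.coe_ne_top (min_le_right _ _)

theorem stopped_of_le {j : ℕ} {t : ℝ≥0} (h : (t : ℝ≥0∞) ≤ π.pt j) : π.stopped j t = t := by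
  rw [stopped, min_eq_right h, ENNReal.toNNReal_coe]

theorem exists_stopped_eq (t : ℝ≥0) : ∃ K, ∀ j ≥ K, π.stopped j t = t := by
  obtain ⟨K, hK⟩ := eventually_atTop.1
    (π.tendsto_top.eventually_const_lt (ENNReal.coe_lt_top (r := t)))
  exact ⟨K, fun j hj => π.stopped_of_le (hK j hj).le⟩

/-- In a Riemann sum `t_j` may be replaced by `t_j ∧ t`: if `t ≤ t_j` the increment vanishes. -/
theorem mul_increment_eq (S : ℝ≥0 → ℝ) (g : ℝ → ℝ) (j : ℕ) (t : ℝ≥0) :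
    g (S (π.pt j).toNNReal) * (S (π.stopped (j + 1) t) - S (π.stopped j t)) =
      g (S (π.stopped j t)) * (S (π.stopped (j + 1) t) - S (π.stopped j t)) := by
  rcases le_total (π.pt j) t with h | h
  · rw [show π.stopped j t = (π.pt j).toNNReal by rw [stopped, min_eq_left h]]
  · rw [π.stopped_of_le h, π.stopped_of_le (h.trans (π.mono j.le_succ)), sub_self, mul_zero,
      mul_zero]

end TimePartition

section DiscreteLocalTime

variable {S : ℝ≥0 → ℝ} {π : TimePartition} {t : ℝ≥0} {K : ℕ} {g : ℝ → ℝ}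

theorem discreteLocalTime_eq_sum (hK : ∀ j ≥ K, π.stopped j t = t) (u : ℝ) :
    discreteLocalTime S π t u = ∑ j ∈ Finset.range K,
      stepKernel (S (π.stopped j t)) (S (π.stopped (j + 1) t)) u := by
  refine tsum_eq_sum fun j hj => ?_
  have hj : K ≤ j := by simpa using hj
  rw [hK j hj, hK (j + 1) (by omega), Set.uIoc, min_self, max_self, Set.Ioc_self,
    Set.indicator_empty]

theorem riemannSum_eq_sum (hK : ∀ j ≥ K, π.stopped j t = t) (g : ℝ → ℝ) :
    riemannSum S π g t = ∑ j ∈ Finset.range K,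
      g (S (π.stopped j t)) * (S (π.stopped (j + 1) t) - S (π.stopped j t)) := by
  simp only [riemannSum, π.mul_increment_eq]
  refine tsum_eq_sum fun j hj => ?_
  have hj : K ≤ j := by simpa using hj
  rw [hK j hj, hK (j + 1) (by omega), sub_self, mul_zero]

theorem riemannSum_congr {h : ℝ → ℝ} (hgh : ∀ s ≤ t, g (S s) = h (S s)) :
    riemannSum S π g t = riemannSum S π h t := by
  simp only [riemannSum, π.mul_increment_eq, hgh _ (π.stopped_le _ t)]

theorem discreteLocalTime_eq_zero {u : ℝ} (hu : ∀ s ≤ t, u ≤ S s) :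
    discreteLocalTime S π t u = 0 := by
  obtain ⟨K, hK⟩ := π.exists_stopped_eq t
  rw [discreteLocalTime_eq_sum hK]
  refine Finset.sum_eq_zero fun j _ => Set.indicator_of_notMem (fun h => ?_) _
  exact (le_min (hu _ (π.stopped_le j t)) (hu _ (π.stopped_le (j + 1) t))).not_gt h.1

theorem stieltjesSum_discreteLocalTime (hK : ∀ j ≥ K, π.stopped j t = t) (n : ℕ) (u : ℕ → ℝ) :
    stieltjesSum (discreteLocalTime S π t) g n u = ∑ j ∈ Finset.range K,
      stieltjesSum (stepKernel (S (π.stopped j t)) (S (π.stopped (j + 1) t))) g n u := by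
  simp only [stieltjesSum, discreteLocalTime_eq_sum hK, Finset.sum_mul]
  exact Finset.sum_comm

theorem integral_sub_riemannSum_eq_sum (hK : ∀ j ≥ K, π.stopped j t = t)
    (hg : ∀ c d : ℝ, IntervalIntegrable g volume c d) :
    (∫ x in S 0..S t, g x) - riemannSum S π g t = ∑ j ∈ Finset.range K,
      ∫ x in S (π.stopped j t)..S (π.stopped (j + 1) t), (g x - g (S (π.stopped j t))) := by
  have hadj := intervalIntegral.sum_integral_adjacent_intervals (f := g) (μ := volume)
    (a := fun j => S (π.stopped j t)) (n := K) fun k _ => hg _ _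
  rw [π.stopped_zero, hK K le_rfl] at hadj
  rw [← hadj, riemannSum_eq_sum hK, ← Finset.sum_sub_distrib]
  refine Finset.sum_congr rfl fun j _ => ?_
  rw [intervalIntegral.integral_sub (hg _ _) intervalIntegrable_const,
    intervalIntegral.integral_const, smul_eq_mul, mul_comm]

/-- The **discrete Tanaka–Meyer formula**. -/
theorem hasYoungIntegralOn_discreteLocalTime {q a b : ℝ} (hq : 0 < q) (hab : a ≤ b)
    (hgc : RightContinuous g) (hg : pVariationOn q g (Set.Icc a b) ≠ ∞) :
    HasYoungIntegralOn (discreteLocalTime S π t) g a b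
      ((∫ x in S 0..S t, constExtend g a b x) - riemannSum S π (constExtend g a b) t) := by
  obtain ⟨K, hK⟩ := π.exists_stopped_eq t
  rw [integral_sub_riemannSum_eq_sum hK (intervalIntegrable_constExtend hq hab hgc hg),
    hasYoungIntegralOn_iff_tendsto]
  simp only [stieltjesSum_discreteLocalTime hK]
  exact tendsto_finsetSum _ fun j _ =>
    hasYoungIntegralOn_iff_tendsto.1 (hasYoungIntegralOn_stepKernel hq hgc hg _ _)

end DiscreteLocalTime

theorem exists_forall_pVariationOn_discreteLocalTime_le {p : ℝ} {π : ℕ → TimePartition}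
    {S : ℝ≥0 → ℝ} (hS : S ∈ localTimePaths p π) (T : ℝ≥0) :
    ∃ V ≠ ∞, ∀ t ≤ T, ∀ n, pVariationOn p (discreteLocalTime S (π n) t) Set.univ ≤ V :=
  ⟨_, (hS.2 (T + 1) (by positivity)).ne, fun t ht n =>
    le_iSup_of_le n (le_iSup₂_of_le t ⟨zero_le, ht.trans le_self_add⟩ le_rfl)⟩

theorem exists_forall_mem_Icc {S : ℝ≥0 → ℝ} (hS : Continuous S) (T : ℝ≥0) :
    ∃ a b, ∀ s ≤ T, S s ∈ Set.Icc a b := by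
  have hc := (isCompact_Icc (a := (0 : ℝ≥0)) (b := T)).image hS
  obtain ⟨a, ha⟩ := hc.bddBelow
  obtain ⟨b, hb⟩ := hc.bddAbove
  exact ⟨a, b, fun s hs => ⟨ha ⟨s, ⟨zero_le, hs⟩, rfl⟩, hb ⟨s, ⟨zero_le, hs⟩, rfl⟩⟩⟩

namespace IsContinuousLocalTime

variable {p q : ℝ} {π : ℕ → TimePartition} {S : ℝ≥0 → ℝ} {L : ℝ≥0 → ℝ → ℝ} {g : ℝ → ℝ}
  {t : ℝ≥0} {a b : ℝ} {V : ℝ≥0∞}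

theorem pVariationOn_le (hL : IsContinuousLocalTime S π L)
    (hV : ∀ n, pVariationOn p (discreteLocalTime S (π n) t) Set.univ ≤ V) (s : Set ℝ) :
    pVariationOn p (L t) s ≤ V :=
  pVariationOn_le_of_tendsto
    (Eventually.of_forall fun n => (pVariationOn_mono_set s.subset_univ).trans (hV n))
    fun x _ => (hL.2.1 t).tendsto_at x

theorem eq_zero (hL : IsContinuousLocalTime S π L) (ha : ∀ s ≤ t, a ≤ S s) : L t a = 0 := by
  refine tendsto_nhds_unique ((hL.2.1 t).tendsto_at a) ?_
  simp only [discreteLocalTime_eq_zero ha, tendsto_const_nhds]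

theorem exists_hasYoungIntegralOn (hL : IsContinuousLocalTime S π L) (hp : 1 ≤ p) (hq : 0 < q)
    (hpq : 1 < 1 / p + 1 / q) (hVtop : V ≠ ∞)
    (hV : ∀ n, pVariationOn p (discreteLocalTime S (π n) t) Set.univ ≤ V)
    (hgc : RightContinuous g) (hab : a ≤ b) (hg : pVariationOn q g (Set.Icc a b) ≠ ∞) :
    ∃ J, HasYoungIntegralOn (L t) g a b J ∧ HasPathwiseIntegral S π (constExtend g a b) t
      ((∫ x in S 0..S t, constExtend g a b x) - J) := by
  obtain ⟨J, hlim, hJ⟩ := HasYoungIntegralOn.exists_of_tendstoUniformlyOn hp hq hpq hab hVtop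
    (hL.2.1 t).tendstoUniformlyOn
    (Eventually.of_forall fun n => (pVariationOn_mono_set (Set.subset_univ _)).trans (hV n)) hg
    fun n => hasYoungIntegralOn_discreteLocalTime (S := S) (π := π n) (t := t) hq hab hgc hg
  refine ⟨J, hJ, (hlim.const_sub (∫ x in S 0..S t, constExtend g a b x)).congr fun n => ?_⟩
  exact sub_sub_cancel _ _

theorem exists_hasYoungIntegralOn_of_forall_mem_Icc (hL : IsContinuousLocalTime S π L)
    (hp : 1 ≤ p) (hq : 0 < q) (hpq : 1 < 1 / p + 1 / q) (hVtop : V ≠ ∞)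
    (hV : ∀ n, pVariationOn p (discreteLocalTime S (π n) t) Set.univ ≤ V)
    (hgc : RightContinuous g) (hSt : ∀ s ≤ t, S s ∈ Set.Icc a b)
    (hg : pVariationOn q g (Set.Icc a b) ≠ ∞) :
    ∃ J, HasYoungIntegralOn (L t) g a b J ∧
      HasPathwiseIntegral S π g t ((∫ x in S 0..S t, g x) - J) := by
  have hab : a ≤ b := (hSt t le_rfl).1.trans (hSt t le_rfl).2
  have hsub : Set.uIcc (S 0) (S t) ⊆ Set.Icc a b :=
    Set.ordConnected_Icc.uIcc_subset (hSt 0 zero_le) (hSt t le_rfl)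
  refine (hL.exists_hasYoungIntegralOn hp hq hpq hVtop hV hgc hab hg).imp fun J hJ => ⟨hJ.1, ?_⟩
  rw [← intervalIntegral.integral_congr fun x hx => constExtend_of_mem (hsub hx)]
  exact hJ.2.congr fun n => riemannSum_congr fun s hs => constExtend_of_mem (hSt s hs)

theorem exists_hasYoungIntegral (hL : IsContinuousLocalTime S π L) (hp : 1 ≤ p) (hq : 0 < q)
    (hpq : 1 < 1 / p + 1 / q) (hS : S ∈ localTimePaths p π) (hgc : RightContinuous g)
    (hg : LocallyFinitePVariation q g) (t : ℝ≥0) :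
    ∃ J, HasPathwiseIntegral S π g t ((∫ x in S 0..S t, g x) - J) ∧ HasYoungIntegral (L t) g J := by
  obtain ⟨V, hVtop, hV⟩ := exists_forall_pVariationOn_discreteLocalTime_le hS t
  obtain ⟨a₀, b₀, hS₀⟩ := exists_forall_mem_Icc hL.1.1 t
  obtain ⟨J₀, -, hpath₀⟩ := hL.exists_hasYoungIntegralOn_of_forall_mem_Icc hp hq hpq hVtop
    (hV t le_rfl) hgc hS₀ (hg a₀ b₀).ne
  have hex : ∀ a b : ℝ, ∃ J, a ≤ b → HasYoungIntegralOn (L t) g a b J := fun a b => by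
    by_cases hab : a ≤ b
    · obtain ⟨J, hJ, -⟩ := hL.exists_hasYoungIntegralOn hp hq hpq hVtop (hV t le_rfl) hgc hab
        (hg a b).ne
      exact ⟨J, fun _ => hJ⟩
    · exact ⟨0, fun h => absurd h hab⟩
  choose J hJ using hex
  refine ⟨J₀, hpath₀, J, hJ, tendsto_const_nhds.congr' ?_⟩
  filter_upwards [(eventually_le_atBot a₀).prod_mk (eventually_ge_atTop b₀)] with ⟨a, b⟩ ⟨ha, hb⟩
  have hSt : ∀ s ≤ t, S s ∈ Set.Icc a b := fun s hs => Set.Icc_subset_Icc ha hb (hS₀ s hs)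
  obtain ⟨J₁, hJ₁, hpath₁⟩ := hL.exists_hasYoungIntegralOn_of_forall_mem_Icc hp hq hpq hVtop
    (hV t le_rfl) hgc hSt (hg a b).ne
  have hab : a ≤ b := (hSt t le_rfl).1.trans (hSt t le_rfl).2
  change J₀ = J a b
  rw [(hJ a b hab).unique hab hJ₁]
  exact sub_right_injective (tendsto_nhds_unique hpath₀ hpath₁)

theorem tendstoUniformlyOn_nhds (hL : IsContinuousLocalTime S π L) {K : Set ℝ} (hK : IsCompact K)
    (t : ℝ≥0) : TendstoUniformlyOn L (L t) (𝓝 t) K := by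
  intro U hU
  obtain ⟨v, hv, hvU⟩ := hK.mem_uniformity_of_prod (f := L) (s := Set.univ)
    hL.2.2.continuousOn (Set.mem_univ t) (symm_le_uniformity hU)
  rw [nhdsWithin_univ] at hv
  filter_upwards [hv] with s hs x hx using hvU s hs x hx

theorem exists_continuousMap_hasPathwiseIntegral (hL : IsContinuousLocalTime S π L) (hp : 1 ≤ p)
    (hq : 0 < q) (hpq : 1 < 1 / p + 1 / q) (hS : S ∈ localTimePaths p π) (hgc : RightContinuous g)
    (hg : LocallyFinitePVariation q g) (T : ℝ≥0) :
    ∃ I : C(Set.Icc 0 T, ℝ), ∀ t : Set.Icc 0 T, HasPathwiseIntegral S π g t (I t) := by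
  obtain ⟨V, hVtop, hV⟩ := exists_forall_pVariationOn_discreteLocalTime_le hS T
  obtain ⟨a, b, hab⟩ := exists_forall_mem_Icc hL.1.1 T
  choose J hJ hpath using fun t : Set.Icc 0 T =>
    hL.exists_hasYoungIntegralOn_of_forall_mem_Icc hp hq hpq hVtop (hV t t.2.2) hgc
      (fun s hs => hab s (hs.trans t.2.2)) (hg a b).ne
  have hJ_cont : Continuous J := continuous_iff_continuousAt.2 fun t => by
    have hunif : TendstoUniformlyOn (fun s : Set.Icc 0 T => L s) (L t) (𝓝 t) (Set.Icc a b) :=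
      fun U hU => continuous_subtype_val.continuousAt.eventually
        (hL.tendstoUniformlyOn_nhds isCompact_Icc t U hU)
    obtain ⟨I, hI, -⟩ := HasYoungIntegralOn.exists_of_tendstoUniformlyOn hp hq hpq
      ((hab T le_rfl).1.trans (hab T le_rfl).2) hVtop hunif
      (Eventually.of_forall fun s => hL.pVariationOn_le (hV s s.2.2) _) (hg a b).ne hJ
    exact continuousAt_of_tendsto_nhds hI
  have hprim_cont : Continuous fun t : Set.Icc 0 T => ∫ x in S 0..S t, g x :=
    (intervalIntegral.continuous_primitive (hg.intervalIntegrable hq hgc) (S 0)).comp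
      (hL.1.1.comp continuous_subtype_val)
  exact ⟨⟨_, hprim_cont.sub hJ_cont⟩, hpath⟩

end IsContinuousLocalTime

section PVarNorm

variable {q : ℝ} {g : ℝ → ℝ}

theorem abs_le_pVarNorm (hq : 0 < q) (hg : pVariationOn q g Set.univ ≠ ∞) (x : ℝ) :
    |g x| ≤ pVarNorm q g := by
  refine (le_ciSup (f := fun x => |g x|) ⟨|g 0| + (pVariationOn q g Set.univ).toReal, ?_⟩ x).trans
    (le_max_right _ _)
  rintro _ ⟨y, rfl⟩
  have hle := abs_sub_le_pVariationOn hq hg (Set.mem_univ y) (Set.mem_univ 0)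
  change |g y| ≤ _
  linarith [abs_sub_abs_le_abs_sub (g y) (g 0)]

theorem pVarNorm_nonneg : 0 ≤ pVarNorm q g :=
  ENNReal.toReal_nonneg.trans (le_max_left _ _)

theorem abs_intervalIntegral_le_mul_pVarNorm (hq : 0 < q) (hg : pVariationOn q g Set.univ ≠ ∞)
    {a b c d : ℝ} (hc : c ∈ Set.Icc a b) (hd : d ∈ Set.Icc a b) :
    |∫ x in c..d, g x| ≤ (b - a) * pVarNorm q g := by
  rw [mul_comm]
  exact (intervalIntegral.norm_integral_le_of_norm_le_const (f := g) fun x _ =>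
    abs_le_pVarNorm hq hg x).trans
      (mul_le_mul_of_nonneg_left (Real.dist_le_of_mem_Icc hd hc) pVarNorm_nonneg)

theorem HasYoungIntegralOn.abs_le_mul_pVarNorm {p a b J : ℝ} {φ : ℝ → ℝ} {V : ℝ≥0∞} (hp : 0 < p)
    (hq : 0 < q) (hpq : 1 < 1 / p + 1 / q) (hab : a ≤ b) (hJ : HasYoungIntegralOn φ g a b J)
    (hφa : φ a = 0) (hVtop : V ≠ ∞) (hφ : pVariationOn p φ (Set.Icc a b) ≤ V)
    (hg : pVariationOn q g Set.univ ≠ ∞) :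
    |J| ≤ (youngConst p q * V).toReal * pVarNorm q g := by
  have hC : youngConst p q * V ≠ ∞ := ENNReal.mul_ne_top (youngConst_ne_top hpq) hVtop
  have hle : ‖J‖ₑ ≤ youngConst p q * V * pVariationOn q g Set.univ := by
    have h := hJ.enorm_sub_le hp hq hab
    rw [hφa, zero_mul, sub_zero] at h
    exact h.trans (mul_le_mul' (mul_le_mul' le_rfl hφ) (pVariationOn_mono_set (Set.subset_univ _)))
  calc |J| = ‖J‖ₑ.toReal := by rw [toReal_enorm, Real.norm_eq_abs]
    _ ≤ (youngConst p q * V).toReal * (pVariationOn q g Set.univ).toReal := by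
      rw [← ENNReal.toReal_mul]
      exact ENNReal.toReal_mono (ENNReal.mul_ne_top hC hg) hle
    _ ≤ _ := mul_le_mul_of_nonneg_left (le_max_left _ _) ENNReal.toReal_nonneg

theorem locallyFinitePVariation_of_univ (hg : pVariationOn q g Set.univ < ∞) :
    LocallyFinitePVariation q g :=
  fun _ _ => (pVariationOn_mono_set (Set.subset_univ _)).trans_lt hg

end PVarNorm

theorem IsContinuousLocalTime.exists_abs_pathwiseIntegral_le {p q : ℝ} {π : ℕ → TimePartition}
    {S : ℝ≥0 → ℝ} {L : ℝ≥0 → ℝ → ℝ} (hL : IsContinuousLocalTime S π L) (hp : 1 ≤ p) (hq : 0 < q)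
    (hpq : 1 < 1 / p + 1 / q) (hS : S ∈ localTimePaths p π) (T : ℝ≥0) :
    ∃ C ≥ 0, ∀ g : ℝ → ℝ, RightContinuous g → pVariationOn q g Set.univ ≠ ∞ → ∀ t ≤ T, ∀ I : ℝ,
      HasPathwiseIntegral S π g t I → |I| ≤ C * pVarNorm q g := by
  obtain ⟨V, hVtop, hV⟩ := exists_forall_pVariationOn_discreteLocalTime_le hS T
  obtain ⟨a, b, hST⟩ := exists_forall_mem_Icc hL.1.1 T
  have hab : a ≤ b := (hST T le_rfl).1.trans (hST T le_rfl).2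
  refine ⟨(b - a) + (youngConst p q * V).toReal,
    add_nonneg (sub_nonneg.2 hab) ENNReal.toReal_nonneg, fun g hgc hg t ht I hI => ?_⟩
  have hSt : ∀ s ≤ t, S s ∈ Set.Icc a b := fun s hs => hST s (hs.trans ht)
  obtain ⟨J, hJ, hpath⟩ := hL.exists_hasYoungIntegralOn_of_forall_mem_Icc hp hq hpq hVtop (hV t ht)
    hgc hSt (locallyFinitePVariation_of_univ hg.lt_top a b).ne
  have hLa : L t a = 0 := hL.eq_zero fun s hs => (hSt s hs).1
  rw [tendsto_nhds_unique hI hpath, add_mul]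
  exact (abs_sub _ _).trans (add_le_add
    (abs_intervalIntegral_le_mul_pVarNorm hq hg (hSt 0 zero_le) (hSt t le_rfl))
    (hJ.abs_le_mul_pVarNorm (one_pos.trans_le hp) hq hpq hab hLa hVtop
      (hL.pVariationOn_le (hV t ht) _) hg))

namespace HasPathwiseIntegral

variable {π : ℕ → TimePartition} {S : ℝ≥0 → ℝ} {g h : ℝ → ℝ} {t : ℝ≥0} {I I' : ℝ}

theorem add (hg : HasPathwiseIntegral S π g t I) (hh : HasPathwiseIntegral S π h t I') :
    HasPathwiseIntegral S π (g + h) t (I + I') := by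
  refine (Tendsto.add hg hh).congr fun n => ?_
  obtain ⟨K, hK⟩ := (π n).exists_stopped_eq t
  simp only [riemannSum_eq_sum hK, ← Finset.sum_add_distrib, Pi.add_apply, add_mul]

theorem const_smul (c : ℝ) (hg : HasPathwiseIntegral S π g t I) :
    HasPathwiseIntegral S π (c • g) t (c * I) := by
  refine (Tendsto.const_mul c hg).congr fun n => ?_
  obtain ⟨K, hK⟩ := (π n).exists_stopped_eq t
  simp only [riemannSum_eq_sum hK, Finset.mul_sum, Pi.smul_apply, smul_eq_mul, mul_assoc]

end HasPathwiseIntegral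

theorem exists_linearMap_hasPathwiseIntegral {π : ℕ → TimePartition} {S : ℝ≥0 → ℝ} {X : Set ℝ≥0}
    {E : Submodule ℝ (ℝ → ℝ)}
    (hE : ∀ g ∈ E, ∃ I : C(X, ℝ), ∀ t : X, HasPathwiseIntegral S π g t (I t)) :
    ∃ A : E →ₗ[ℝ] C(X, ℝ), ∀ (g : E) (t : X), HasPathwiseIntegral S π g t (A g t) := by
  choose I hI using fun g : E => hE g g.2
  exact ⟨{ toFun := I
           map_add' := fun g h => ContinuousMap.ext fun t =>
            tendsto_nhds_unique (hI (g + h) t) ((hI g t).add (hI h t))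
           map_smul' := fun c g => ContinuousMap.ext fun t =>
            tendsto_nhds_unique (hI (c • g) t) ((hI g t).const_smul c) }, hI⟩

theorem IsAbsolutelyContinuousWithDeriv.integral_eq_sub {f f' : ℝ → ℝ}
    (hf : IsAbsolutelyContinuousWithDeriv f f') (c d : ℝ) : ∫ x in c..d, f' x = f d - f c := by
  rw [← (hf.1 c d).integral_deriv_eq_sub]
  exact intervalIntegral.integral_congr_ae (hf.2.mono fun x hx _ => hx.deriv.symm)

theorem theorem2p5 (p q : ℝ) (hp : 1 ≤ p) (hq : 1 ≤ q) (hpq : 1 < 1 / p + 1 / q)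
    (π : ℕ → TimePartition) (S : ℝ≥0 → ℝ) (hS : S ∈ localTimePaths p π)
    (L : ℝ≥0 → ℝ → ℝ) (hL : IsContinuousLocalTime S π L) :
    (∀ f f' : ℝ → ℝ, IsAbsolutelyContinuousWithDeriv f f' → RightContinuous f' →
      LocallyFinitePVariation q f' → ∀ t : ℝ≥0, ∃ I J : ℝ,
        HasPathwiseIntegral S π f' t I ∧ HasYoungIntegral (L t) f' J ∧
        f (S t) = f (S 0) + I + J) ∧
    (∀ g : ℝ → ℝ, RightContinuous g → LocallyFinitePVariation q g →
      ∀ t : ℝ≥0, ∃ I : ℝ, HasPathwiseIntegral S π g t I) ∧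
    (∀ T : ℝ≥0, 0 < T →
      ∃ A : pVarSpace q hq →ₗ[ℝ] C(Set.Icc (0 : ℝ≥0) T, ℝ),
        (∀ (g : pVarSpace q hq) (t : Set.Icc (0 : ℝ≥0) T), HasPathwiseIntegral S π g t (A g t)) ∧
        ∃ C : ℝ, ∀ g : pVarSpace q hq, ‖A g‖ ≤ C * pVarNorm q g) := by
  have hq0 : 0 < q := one_pos.trans_le hq
  refine ⟨fun f f' hf hfc hfq t => ?_, fun g hgc hg t => ?_, fun T _ => ?_⟩
  · obtain ⟨J, hI, hJ⟩ := hL.exists_hasYoungIntegral hp hq0 hpq hS hfc hfq t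
    refine ⟨_, J, hI, hJ, ?_⟩
    rw [hf.integral_eq_sub]
    ring
  · obtain ⟨J, hI, -⟩ := hL.exists_hasYoungIntegral hp hq0 hpq hS hgc hg t
    exact ⟨_, hI⟩
  · obtain ⟨A, hA⟩ := exists_linearMap_hasPathwiseIntegral (E := pVarSpace q hq) fun g hg =>
      hL.exists_continuousMap_hasPathwiseIntegral hp hq0 hpq hS hg.1
        (locallyFinitePVariation_of_univ hg.2) T
    obtain ⟨C, hC, hbound⟩ := hL.exists_abs_pathwiseIntegral_le hp hq0 hpq hS T
    refine ⟨A, hA, C, fun g => ?_⟩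
    rw [ContinuousMap.norm_le _ (mul_nonneg hC pVarNorm_nonneg)]
    exact fun t => hbound g g.2.1 g.2.2.ne t t.2.2 _ (hA g t)
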